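/- Let $X$ be a complex Banach space with open unit ball $B_X$. Let $\mathcal H^\infty(B_X)$ be the Banach algebra of bounded holomorphic functions $B_X\to\mathbb C$ and $\mathcal A_u(B_X)$ the Banach algebra of uniformly continuous holomorphic functions $B_X\to\mathbb C$, both with the supremum norm, and let $\mathcal A$ be one of these two algebras. Let $\mathcal M(\mathcal A)$ be the set of nonzero (automatically continuous) homomorphisms $\mathcal A\to\mathbb C$, with the Gleason metric $\|\varphi-\psi\|$ (the norm of $\mathcal A^*$). For $z\in\overline B_{X^{**}}$ let $\mathcal M_z=\{\varphi\in\mathcal M(\mathcal A):\varphi|_{X^*}=z\}$, where $X^*\subset\mathcal A$ by restriction to $B_X$; regard $X\subset X^{**}$. Let $\Phi\colon B_X\to B_X$ be an automorphism (a holomorphic bijection with holomorphic inverse); if $\mathcal A=\mathcal A_u(B_X)$, assume also that $\Phi$ and $\Phi^{-1}$ are uniformly continuous. (i) For $f\in\mathcal A$ the functions $f\circ\Phi$ and $f\circ\Phi^{-1}$ belong to $\mathcal A$, so that there is a composition operator $C_\Phi\colon\mathcal A\to\mathcal A$, $C_\Phi(f)=f\circ\Phi$. The restriction of its transpose, $\Lambda_\Phi\colon\mathcal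 M(\mathcal A)\to\mathcal M(\mathcal A)$, $\Lambda_\Phi(\varphi)=\varphi\circ C_\Phi$, is a surjective isometry for the Gleason metric, with inverse $\Lambda_\Phi^{-1}=\Lambda_{\Phi^{-1}}$. (ii) Suppose that for every $x^*\in X^*$ the functions $x^*\circ\Phi$ and $x^*\circ\Phi^{-1}$ are uniform limits on $B_X$ of finite type polynomials (elements of the unital algebra of functions generated by $X^*$). Then $\Phi$ has a unique extension to a map from $\overline B_X$ to $\overline B_{X^{**}}$ that is continuous from the norm topology to the weak-star topology; denoting it again by $\Phi$, we have $\Lambda_\Phi(\mathcal M_x)=\mathcal M_{\Phi(x)}$ for every $x\in\overline B_X$. If $\Phi$ is uniformly continuous (in particular if $\mathcal A=\mathcal A_u(B_X)$), the same holds with $\Phi\colon\overline B_X\to\overline B_X$ the unique norm continuous extension. (iii) Suppose in addition to the hypothesis of (ii) that $X$ is symmetrically regular, that is, every continuous linear map $T\colon X\to X^*$ with $T(x)(y)=T(y)(x)$ for all $x,y\in X$ is weakly compact. For a bounded holomorphic function $f=\sum_n P_n$ on $B_X$ (Taylor series at $0$) let $\tilde f=\sum_n\tilde P_n$ be its canonical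 extension to $B_{X^{**}}$, where $\tilde P_n$ is the Aron--Berner extension of the $n$-homogeneous polynomial $P_n$. Then there is a unique weak-star continuous map $\tilde\Phi\colon\overline B_{X^{**}}\to\overline B_{X^{**}}$ such that $\tilde\Phi(z)(x^*)=\widetilde{x^*\circ\Phi}(z)$ for all $z\in B_{X^{**}}$ and $x^*\in X^*$, and $\Lambda_\Phi(\mathcal M_z)=\mathcal M_{\tilde\Phi(z)}$ for every $z\in\overline B_{X^{**}}$. -/

import Mathlib

open Metric

set_option linter.unusedSectionVars false

noncomputable section

namespace BallAlgebra

variable {X : Type*} [NormedAddCommGroup X] [NormedSpace ℂ X]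

/-- The open unit ball of `X`, as a type. -/
abbrev Ball (X : Type*) [NormedAddCommGroup X] : Type _ := ball (0 : X) 1

/-- The closed unit ball of `X`, with the norm topology. -/
abbrev ClosedBall (X : Type*) [NormedAddCommGroup X] : Type _ := closedBall (0 : X) 1

/-- The bidual of `X`, as a Banach space. -/
abbrev Bidual (X : Type*) [NormedAddCommGroup X] [NormedSpace ℂ X] : Type _ :=
  StrongDual ℂ (StrongDual ℂ X)

/-- The closed unit ball of the bidual of `X`, with the weak-star topology. -/
abbrev BidualBall (X : Type*) [NormedAddCommGroup X] [NormedSpace ℂ X] : Type _ :=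
  {z : WeakDual ℂ (StrongDual ℂ X) // ‖WeakDual.toStrongDual z‖ ≤ 1}

/-- A point of the closed unit ball of the bidual, as an element of the Banach space `X**`. -/
def bidualPt (z : BidualBall X) : Bidual X := WeakDual.toStrongDual z.1

/-- The canonical embedding `X → X**`. -/
def toBidual (x : X) : Bidual X := NormedSpace.inclusionInDoubleDual ℂ X x

/-- The extension by zero of a function on the open unit ball. -/
def zeroExt {E : Type*} [Zero E] (f : Ball X → E) (x : X) : E :=
  open Classical in if h : x ∈ ball (0 : X) 1 then f ⟨x, h⟩ else 0

/-- `f` is holomorphic (complex-analytic) on the open unit ball. -/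
def Holomorphic {E : Type*} [NormedAddCommGroup E] [NormedSpace ℂ E] (f : Ball X → E) : Prop :=
  AnalyticOnNhd ℂ (zeroExt f) (ball (0 : X) 1)

lemma holomorphic_of {E : Type*} [NormedAddCommGroup E] [NormedSpace ℂ E] {f : Ball X → E}
    (F : X → E) (hF : AnalyticOnNhd ℂ F (ball (0 : X) 1)) (h : ∀ x : Ball X, F x = f x) :
    Holomorphic f := by
  refine hF.congr isOpen_ball ?_
  intro x hx
  simp only [zeroExt, dif_pos hx]
  exact h ⟨x, hx⟩

lemma zeroExt_coe {E : Type*} [Zero E] (f : Ball X → E) (x : Ball X) :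
    zeroExt f (x : X) = f x := by
  simp only [zeroExt, dif_pos x.2]

/-- The Banach algebra of bounded holomorphic functions on the open unit ball, with the
supremum norm. -/
def Hinf (X : Type*) [NormedAddCommGroup X] [NormedSpace ℂ X] :
    Subalgebra ℂ (BoundedContinuousFunction (Ball X) ℂ) where
  carrier := {f | Holomorphic f}
  mul_mem' {f g} hf hg :=
    holomorphic_of (fun x => zeroExt f x * zeroExt g x) (AnalyticOnNhd.mul hf hg)
      fun x => by simp [zeroExt_coe]
  add_mem' {f g} hf hg :=
    holomorphic_of (fun x => zeroExt f x + zeroExt g x) (AnalyticOnNhd.add hf hg)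
      fun x => by simp [zeroExt_coe]
  algebraMap_mem' c := holomorphic_of (fun _ => c) analyticOnNhd_const fun _ => rfl

lemma uniformContinuous_mul (f g : BoundedContinuousFunction (Ball X) ℂ)
    (hf : UniformContinuous f) (hg : UniformContinuous g) :
    UniformContinuous (f * g : BoundedContinuousFunction (Ball X) ℂ) := by
  rw [Metric.uniformContinuous_iff] at *
  intro ε hε
  have hC : 0 < ‖f‖ + ‖g‖ + 1 := by positivity
  have hδ : 0 < ε / (‖f‖ + ‖g‖ + 1) := by positivity
  obtain ⟨a, ha, hfa⟩ := hf _ hδ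
  obtain ⟨b, hb, hgb⟩ := hg _ hδ
  refine ⟨min a b, lt_min ha hb, fun {x y} hxy => ?_⟩
  have h1 := hfa (lt_of_lt_of_le hxy (min_le_left _ _))
  have h2 := hgb (lt_of_lt_of_le hxy (min_le_right _ _))
  rw [dist_eq_norm] at h1 h2 ⊢
  have e : (f * g : BoundedContinuousFunction (Ball X) ℂ) x
      - (f * g : BoundedContinuousFunction (Ball X) ℂ) y
      = f x * (g x - g y) + (f x - f y) * g y := by
    simp only [BoundedContinuousFunction.coe_mul, Pi.mul_apply]; ring
  rw [e]
  have hfx := f.norm_coe_le_norm x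
  have hgy := g.norm_coe_le_norm y
  calc ‖f x * (g x - g y) + (f x - f y) * g y‖
      ≤ ‖f x‖ * ‖g x - g y‖ + ‖f x - f y‖ * ‖g y‖ := by
        refine (norm_add_le _ _).trans ?_
        rw [norm_mul, norm_mul]
    _ ≤ ‖f‖ * (ε / (‖f‖ + ‖g‖ + 1)) + (ε / (‖f‖ + ‖g‖ + 1)) * ‖g‖ := by gcongr
    _ < (‖f‖ + ‖g‖ + 1) * (ε / (‖f‖ + ‖g‖ + 1)) := by nlinarith
    _ = ε := by field_simp

/-- The Banach algebra of uniformly continuous holomorphic functions on the open unit ball, with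
the supremum norm. (Uniformly continuous functions on the ball are bounded.) -/
def Au (X : Type*) [NormedAddCommGroup X] [NormedSpace ℂ X] :
    Subalgebra ℂ (BoundedContinuousFunction (Ball X) ℂ) where
  carrier := {f | Holomorphic f ∧ UniformContinuous f}
  mul_mem' {f g} hf hg := ⟨(Hinf X).mul_mem hf.1 hg.1, uniformContinuous_mul f g hf.2 hg.2⟩
  add_mem' hf hg := ⟨(Hinf X).add_mem hf.1 hg.1, hf.2.add hg.2⟩
  algebraMap_mem' c := ⟨(Hinf X).algebraMap_mem c, uniformContinuous_const⟩

/-- The two algebras under consideration. -/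
inductive Kind
  | unif
  | bdd

/-- `𝒜_u(B_X)` or `ℋ^∞(B_X)`. -/
def alg (X : Type*) [NormedAddCommGroup X] [NormedSpace ℂ X] :
    Kind → Subalgebra ℂ (BoundedContinuousFunction (Ball X) ℂ)
  | .unif => Au X
  | .bdd => Hinf X

/-- The spectrum `ℳ(𝒜)`: nonzero continuous complex homomorphisms of `𝒜`. -/
abbrev Spectrum (X : Type*) [NormedAddCommGroup X] [NormedSpace ℂ X] (k : Kind) : Type _ :=
  WeakDual.characterSpace ℂ (alg X k)

/-- The Gleason metric `‖φ - ψ‖` (norm of `𝒜*`). -/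
def gleasonDist {k : Kind} (φ ψ : Spectrum X k) : ℝ :=
  ‖WeakDual.toStrongDual (φ : WeakDual ℂ (alg X k)) -
    WeakDual.toStrongDual (ψ : WeakDual ℂ (alg X k))‖

lemma norm_apply_ball_le (ℓ : StrongDual ℂ X) (x : Ball X) : ‖ℓ x‖ ≤ ‖ℓ‖ :=
  (ℓ.le_opNorm x).trans (by
    have : ‖(x : X)‖ ≤ 1 := (mem_ball_zero_iff.1 x.2).le
    nlinarith [norm_nonneg ℓ])

/-- The restriction to the open unit ball of a continuous linear functional. -/
def dualFun (ℓ : StrongDual ℂ X) : BoundedContinuousFunction (Ball X) ℂ :=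
  BoundedContinuousFunction.ofNormedAddCommGroup (fun x : Ball X => ℓ x)
    (ℓ.continuous.comp continuous_subtype_val) ‖ℓ‖
    (norm_apply_ball_le ℓ)

lemma dualFun_mem (k : Kind) (ℓ : StrongDual ℂ X) : dualFun ℓ ∈ alg X k := by
  have h : Holomorphic (dualFun ℓ) :=
    holomorphic_of ℓ (ℓ.analyticOnNhd _) fun _ => rfl
  cases k with
  | unif => exact ⟨h, ℓ.uniformContinuous.comp uniformContinuous_subtype_val⟩
  | bdd => exact h

/-- The inclusion `X* ⊆ 𝒜`. -/
def dualIncl (k : Kind) : StrongDual ℂ X →L[ℂ] alg X k :=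
  LinearMap.mkContinuous
    { toFun := fun ℓ => ⟨dualFun ℓ, dualFun_mem k ℓ⟩
      map_add' := fun _ _ => rfl
      map_smul' := fun _ _ => rfl } 1 fun ℓ => by
    rw [one_mul]
    exact BoundedContinuousFunction.norm_ofNormedAddCommGroup_le _ (norm_nonneg ℓ)
      (norm_apply_ball_le ℓ)

/-- The projection `π(φ) = φ|_{X*}` from the spectrum to the bidual. -/
def proj {k : Kind} (φ : Spectrum X k) : Bidual X :=
  (WeakDual.toStrongDual (φ : WeakDual ℂ (alg X k))).comp (dualIncl k)

/-- The fiber `ℳ_z` of the spectrum over a point `z` of the bidual. -/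
def fiber (k : Kind) (z : Bidual X) : Set (Spectrum X k) := {φ | proj φ = z}

/-- A (biholomorphic) automorphism of the open unit ball. -/
structure Automorphism (X : Type*) [NormedAddCommGroup X] [NormedSpace ℂ X] where
  toEquiv : Ball X ≃ Ball X
  holo : Holomorphic fun x => (toEquiv x : X)
  holo_symm : Holomorphic fun x => (toEquiv.symm x : X)

/-- The inverse automorphism. -/
def Automorphism.symm (Φ : Automorphism X) : Automorphism X :=
  ⟨Φ.toEquiv.symm, Φ.holo_symm, Φ.holo⟩

lemma Holomorphic.continuous (f : Ball X → X) (hf : Holomorphic f) : Continuous f := by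
  have h := continuousOn_iff_continuous_domRestrict.1 (AnalyticOnNhd.continuousOn hf)
  refine h.congr fun x => ?_
  exact zeroExt_coe f x

lemma Automorphism.continuous (Φ : Automorphism X) : Continuous Φ.toEquiv :=
  continuous_induced_rng.2 (Holomorphic.continuous _ Φ.holo)

/-- The function `f ∘ Φ`, for `f` bounded and continuous on the ball. -/
def pullback (Φ : Automorphism X) (f : BoundedContinuousFunction (Ball X) ℂ) :
    BoundedContinuousFunction (Ball X) ℂ :=
  f.compContinuous ⟨Φ.toEquiv, Φ.continuous⟩

/-- `f ∘ Φ ∈ 𝒜` for every `f ∈ 𝒜`. -/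
def Preserves (k : Kind) (Φ : Automorphism X) : Prop := ∀ f ∈ alg X k, pullback Φ f ∈ alg X k

/-- The composition operator `C_Φ : 𝒜 → 𝒜`, `C_Φ f = f ∘ Φ`. -/
def compOp {k : Kind} {Φ : Automorphism X} (h : Preserves k Φ) : alg X k →A[ℂ] alg X k where
  toFun f := ⟨pullback Φ f.1, h f.1 f.2⟩
  map_one' := rfl
  map_mul' _ _ := rfl
  map_zero' := rfl
  map_add' _ _ := rfl
  commutes' _ := rfl
  cont := (BoundedContinuousFunction.continuous_compContinuous _).comp
    continuous_subtype_val |>.subtype_mk _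

/-- The restriction of the transpose of `C_Φ` to the spectrum, `Λ_Φ φ = φ ∘ C_Φ`. -/
def spectrumMap {k : Kind} {Φ : Automorphism X} (h : Preserves k Φ) (φ : Spectrum X k) :
    Spectrum X k :=
  ⟨StrongDual.toWeakDual ((WeakDual.toStrongDual (φ : WeakDual ℂ (alg X k))).comp
      (compOp h).toContinuousLinearMap), by
    refine WeakDual.CharacterSpace.eq_set_map_one_map_mul.symm.subset ⟨?_, fun f g => ?_⟩
    · exact map_one φ
    · exact map_mul φ (compOp h f) (compOp h g)⟩

/-- The finite type polynomials on `X`: the (unital) algebra of functions generated by `X*`. -/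
def finiteType (X : Type*) [NormedAddCommGroup X] [NormedSpace ℂ X] : Subalgebra ℂ (X → ℂ) :=
  Algebra.adjoin ℂ (Set.range fun (ℓ : StrongDual ℂ X) (x : X) => ℓ x)

/-- `f` is a uniform limit, on the open unit ball, of finite type polynomials. -/
def IsUniformLimitFiniteType (f : Ball X → ℂ) : Prop :=
  ∃ Q : ℕ → X → ℂ, (∀ n, Q n ∈ finiteType X) ∧
    TendstoUniformly (fun n (x : Ball X) => Q n x) f Filter.atTop

/-- `X` is symmetrically regular: every symmetric continuous linear `T : X → X*` is weakly
compact, i.e. maps the closed unit ball to a relatively weakly compact set. -/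
def SymmetricallyRegular (X : Type*) [NormedAddCommGroup X] [NormedSpace ℂ X] : Prop :=
  ∀ T : X →L[ℂ] StrongDual ℂ X, (∀ x y, T x y = T y x) →
    IsCompact (closure (toWeakSpace ℂ (StrongDual ℂ X) '' (T '' closedBall (0 : X) 1)))

/-- The value on the diagonal `(z, …, z)` of the Aron–Berner extension to the bidual of an
`n`-linear form `A` on `X`, i.e. the iterated weak-star limit of `A (x₁, …, xₙ)` as first
`xₙ → z`, then `xₙ₋₁ → z`, …, and finally `x₁ → z`. The outermost limit is obtained by applying
`z` to the functional which sends `x` to the extension of `A (x, ·)`. -/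
def aronBerner (z : Bidual X) :
    (n : ℕ) → ContinuousMultilinearMap ℂ (fun _ : Fin n => X) ℂ →L[ℂ] ℂ
  | 0 => ContinuousMultilinearMap.apply ℂ (fun _ : Fin 0 => X) ℂ 0
  | n + 1 => z.comp ((ContinuousLinearMap.compL ℂ X
        (ContinuousMultilinearMap ℂ (fun _ : Fin n => X) ℂ) ℂ (aronBerner z n)).comp
      ((continuousMultilinearCurryLeftEquiv ℂ (fun _ : Fin (n + 1) => X) ℂ).toContinuousLinearEquiv :
        ContinuousMultilinearMap ℂ (fun _ : Fin (n + 1) => X) ℂ →L[ℂ]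
          X →L[ℂ] ContinuousMultilinearMap ℂ (fun _ : Fin n => X) ℂ))

/-- The canonical extension `f̃(z) = ∑ₙ P̃ₙ(z)` to the open unit ball of the bidual of a bounded
holomorphic function `f = ∑ₙ Pₙ` on the open unit ball of `X`, where `Pₙ` is the `n`-th Taylor
polynomial of `f` at `0` and `P̃ₙ` its Aron–Berner extension. -/
def canonicalExt (f : Ball X → ℂ) (z : Bidual X) : ℂ :=
  ∑' n : ℕ, ((n.factorial : ℂ))⁻¹ * aronBerner z n (iteratedFDeriv ℂ n (zeroExt f) 0)

/-- `Ψ` is the canonical extension `Φ̃` of `Φ` to the closed unit ball of the bidual: on the open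
unit ball of `X**` it is given by `Φ̃(z)(x*) = (x* ∘ Φ)~(z)`, and it is weak-star continuous on the
closed unit ball. -/
def IsCanonicalExtension (Φ : Automorphism X) (Ψ : C(BidualBall X, BidualBall X)) : Prop :=
  ∀ z : BidualBall X, ‖bidualPt z‖ < 1 → ∀ ℓ : StrongDual ℂ X,
    bidualPt (Ψ z) ℓ = canonicalExt (fun x => ℓ (Φ.toEquiv x)) (bidualPt z)

/-- `Φ'` is a continuous extension of `Φ` to the closed unit ball of `X`. -/
def IsContinuousExtension (Φ : Automorphism X) (Φ' : C(ClosedBall X, ClosedBall X)) : Prop :=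
  ∀ x : Ball X, (Φ' ⟨x, ball_subset_closedBall x.2⟩ : X) = Φ.toEquiv x

/-- `Φ'` is a norm-to-weak-star continuous extension of `Φ` to the closed unit ball of `X`, with
values in the closed unit ball of `X**`. -/
def IsWeakStarExtension (Φ : Automorphism X) (Φ' : C(ClosedBall X, BidualBall X)) : Prop :=
  ∀ x : Ball X, bidualPt (Φ' ⟨x, ball_subset_closedBall x.2⟩) = toBidual (Φ.toEquiv x : X)

end BallAlgebra

end

noncomputable section

namespace BallAlgebra

variable {X : Type*} [NormedAddCommGroup X] [NormedSpace ℂ X]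

open Filter Topology

/-! ### Goldstine's theorem -/

/-! Composition with `Φ` or with its inverse is contractive on the algebra, so `Λ_Φ` and its inverse
are both 1-Lipschitz for the Gleason metric, hence isometric.

For the fibers, let `π` be restriction to `X*`. It is continuous from the compact spectrum to the
weak-star bidual ball, and its image contains the open ball of `X`; by Goldstine it is onto, hence a
quotient map (`isQuotientMap_projBall`). A character takes on a uniform limit of finite type
polynomials a value depending only on its image under `π` (`character_eq_of_proj_eq`). Applied to `ℓ
∘ Φ`, this makes `Λ_Φ` descend to a weak-star continuous self-map `Ψ` of the bidual ball
(`exists_inducedMap`), and the same property of the inverse turns inclusion of fibers into equality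
(`image_fiber_eq`).

Every extension in the statement is then identified with `Ψ` by density. That `Ψ` is given by Taylor
series is `character_eq_canonicalExt`: approximating polynomials converge uniformly on complex discs
`t ↦ t • w` in the bidual, so their Taylor coefficients converge there, while Cauchy estimates on
`X` show that the limits are the Aron–Berner values of the derivatives of the limit function. -/

lemma norm_toBidual_le (x : X) : ‖toBidual x‖ ≤ ‖x‖ :=
  NormedSpace.double_dual_bound ℂ X x

/-- The canonical map from the closed unit ball of `X` to that of the bidual. -/
def inclBall (x : ClosedBall X) : BidualBall X :=
  ⟨StrongDual.toWeakDual (toBidual (x : X)),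
    (norm_toBidual_le (x : X)).trans (mem_closedBall_zero_iff.1 x.2)⟩

lemma bidualPt_injective : Function.Injective (bidualPt : BidualBall X → Bidual X) :=
  fun _ _ h => Subtype.ext (WeakDual.toStrongDual.injective h)

/-- A map into the bidual ball is continuous if it is so after evaluation at functionals. -/
lemma continuous_bidualBall {α : Type*} [TopologicalSpace α] {g : α → BidualBall X}
    (hg : ∀ ℓ : StrongDual ℂ X, Continuous fun a => bidualPt (g a) ℓ) : Continuous g :=
  Continuous.subtype_mk (WeakDual.continuous_of_continuous_eval hg) _

lemma continuous_inclBall : Continuous (inclBall : ClosedBall X → BidualBall X) :=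
  continuous_bidualBall fun ℓ => ℓ.continuous.comp continuous_subtype_val

/-- The ball is invariant under unimodular scalars, so `x` can be rotated until `ℓ x` equals its
modulus. -/
lemma norm_le_of_forall_re_le (ℓ : StrongDual ℂ X) {u : ℝ}
    (h : ∀ x ∈ ball (0 : X) 1, (ℓ x).re ≤ u) : ‖ℓ‖ ≤ u := by
  refine le_of_forall_lt fun r hr => ?_
  obtain ⟨x, hx, hrx⟩ := ContinuousLinearMap.exists_lt_apply_of_lt_opNorm ℓ hr
  obtain ⟨c, hc, hcx⟩ := RCLike.exists_norm_eq_mul_self (ℓ x)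
  have h1 := h (c • x) (by rw [mem_ball_zero_iff, norm_smul, hc, one_mul]; exact hx)
  rw [map_smul, smul_eq_mul, ← hcx] at h1
  exact hrx.trans_le (by simpa using h1)

/-- In a weak topology, a point that cannot be separated from a convex set lies in its closure. -/
lemma mem_closure_weakBilin {E F : Type*} [AddCommGroup E] [Module ℂ E] [Module ℝ E]
    [IsScalarTower ℝ ℂ E] [AddCommGroup F] [Module ℂ F] (B : E →ₗ[ℂ] F →ₗ[ℂ] ℂ)
    {s : Set E} (hs : Convex ℝ s) (x : E)
    (h : ∀ (y : F) (u : ℝ), (∀ a ∈ s, (B a y).re ≤ u) → (B x y).re ≤ u) :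
    x ∈ closure (X := WeakBilin B) s := by
  by_contra hx
  have : ContinuousSMul ℝ (WeakBilin B) := IsScalarTower.continuousSMul ℂ
  have hs' : Convex (E := WeakBilin B) ℝ s := hs
  obtain ⟨g, u, hg, hu⟩ :=
    RCLike.geometric_hahn_banach_closed_point (𝕜 := ℂ) hs'.closure isClosed_closure hx
  obtain ⟨y, rfl⟩ := LinearMap.dualEmbedding_surjective B g
  exact (h y u fun a ha => (hg a (subset_closure ha)).le).not_gt hu

/-- **Goldstine's theorem**: the open unit ball of `X` is weak-star dense in the closed unit ball
of the bidual. -/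
theorem dense_range_inclBall_ball :
    DenseRange fun x : Ball X => inclBall (X := X) ⟨x, ball_subset_closedBall x.2⟩ := by
  intro z
  have hconv : Convex ℝ (toBidual '' ball (0 : X) 1) :=
    (convex_ball (0 : X) 1).linear_image
      ((NormedSpace.inclusionInDoubleDual ℂ X).toLinearMap.restrictScalars ℝ)
  have key := mem_closure_weakBilin (topDualPairing ℂ (StrongDual ℂ X)) hconv (bidualPt z) <| by
    intro ℓ u hs
    have hℓ : ‖ℓ‖ ≤ u := norm_le_of_forall_re_le ℓ fun x hx =>
      hs (toBidual x) (Set.mem_image_of_mem _ hx)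
    have h1 : ‖bidualPt z ℓ‖ ≤ ‖ℓ‖ := by
      simpa using (bidualPt z).le_of_opNorm_le z.2 ℓ
    exact (Complex.re_le_norm _).trans (h1.trans hℓ)
  rw [closure_subtype]
  refine closure_mono (X := WeakDual ℂ (StrongDual ℂ X)) ?_ key
  rintro _ ⟨x, hx, rfl⟩
  exact ⟨_, ⟨⟨x, hx⟩, rfl⟩, rfl⟩

/-! ### The spectrum and its projection to the bidual ball -/

/-- Otherwise `f / φ f` has norm below 1, so its powers tend to 0 although `φ` maps each of them to
1. -/
lemma norm_character_apply_le {k : Kind} (φ : Spectrum X k) (f : alg X k) : ‖φ f‖ ≤ ‖f‖ := by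
  by_contra! h
  have hne : φ f ≠ 0 := norm_pos_iff.1 ((norm_nonneg f).trans_lt h)
  have hg : ‖(φ f)⁻¹ • f‖ < 1 := by
    rw [norm_smul, norm_inv, inv_mul_lt_one₀ (norm_pos_iff.2 hne)]
    exact h
  have h1 : Tendsto (fun n : ℕ => φ (((φ f)⁻¹ • f) ^ n)) atTop (𝓝 (φ 0)) :=
    ((map_continuous φ).tendsto 0).comp (tendsto_pow_atTop_nhds_zero_of_norm_lt_one hg)
  have h2 : ∀ n : ℕ, φ (((φ f)⁻¹ • f) ^ n) = 1 := fun n => by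
    rw [map_pow, map_smul, smul_eq_mul, inv_mul_cancel₀ hne, one_pow]
  simp only [h2, map_zero] at h1
  exact one_ne_zero (tendsto_nhds_unique tendsto_const_nhds h1)

instance spectrumCompactSpace (k : Kind) : CompactSpace (Spectrum X k) := by
  rw [← isCompact_iff_compactSpace]
  refine (WeakDual.isCompact_closedBall (𝕜 := ℂ) (0 : StrongDual ℂ (alg X k)) 1).of_isClosed_subset
    WeakDual.CharacterSpace.isClosed fun φ hφ => ?_
  rw [Set.mem_preimage, mem_closedBall_zero_iff]
  refine ContinuousLinearMap.opNorm_le_bound _ zero_le_one fun f => ?_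
  rw [one_mul]
  exact norm_character_apply_le ⟨φ, hφ⟩ f

lemma norm_proj_le {k : Kind} (φ : Spectrum X k) : ‖proj φ‖ ≤ 1 := by
  refine ContinuousLinearMap.opNorm_le_bound _ zero_le_one fun ℓ => ?_
  refine (norm_character_apply_le φ (dualIncl k ℓ)).trans ?_
  exact (dualIncl k).le_of_opNorm_le (LinearMap.mkContinuous_norm_le _ zero_le_one _) ℓ

/-- The projection from the spectrum to the closed unit ball of the bidual. -/
def projBall {k : Kind} (φ : Spectrum X k) : BidualBall X :=
  ⟨StrongDual.toWeakDual (proj φ), norm_proj_le φ⟩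

lemma continuous_character_apply {k : Kind} (f : alg X k) :
    Continuous fun φ : Spectrum X k => φ f :=
  (WeakDual.eval_continuous f).comp continuous_subtype_val

lemma continuous_projBall {k : Kind} : Continuous (projBall : Spectrum X k → BidualBall X) :=
  continuous_bidualBall fun ℓ => continuous_character_apply (dualIncl k ℓ)

/-- Evaluation at a point of the ball. -/
def evalChar (k : Kind) (x : Ball X) : Spectrum X k :=
  ⟨StrongDual.toWeakDual ((BoundedContinuousFunction.evalCLM ℂ x).comp
      (Subalgebra.toSubmodule (alg X k)).subtypeL), by
    refine WeakDual.CharacterSpace.eq_set_map_one_map_mul.symm.subset ⟨?_, fun f g => ?_⟩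
    · rfl
    · rfl⟩

lemma projBall_evalChar (k : Kind) (x : Ball X) :
    projBall (evalChar k x) = inclBall (X := X) ⟨x, ball_subset_closedBall x.2⟩ := rfl

/-- The range is compact, hence closed, and contains the dense open ball of `X` through the
evaluations. -/
theorem surjective_projBall {k : Kind} :
    Function.Surjective (projBall : Spectrum X k → BidualBall X) := by
  rw [← Set.range_eq_univ, ← (isCompact_range continuous_projBall).isClosed.closure_eq]
  refine Dense.closure_eq (dense_range_inclBall_ball.mono ?_)
  rintro _ ⟨x, rfl⟩
  exact ⟨evalChar k x, projBall_evalChar k x⟩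

lemma isQuotientMap_projBall {k : Kind} :
    Topology.IsQuotientMap (projBall : Spectrum X k → BidualBall X) :=
  continuous_projBall.isClosedMap.isQuotientMap continuous_projBall surjective_projBall

/-! ### Composition operators -/

lemma Holomorphic.comp_automorphism {E : Type*} [NormedAddCommGroup E] [NormedSpace ℂ E]
    {f : Ball X → E} (hf : Holomorphic f) (Φ : Automorphism X) :
    Holomorphic fun x => f (Φ.toEquiv x) := by
  refine holomorphic_of (fun x => zeroExt f (zeroExt (fun y => (Φ.toEquiv y : X)) x)) ?_ ?_
  · refine AnalyticOnNhd.comp hf Φ.holo fun x hx => ?_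
    rw [zeroExt_coe _ ⟨x, hx⟩]
    exact (Φ.toEquiv ⟨x, hx⟩).2
  · intro x
    rw [zeroExt_coe, zeroExt_coe]

lemma preserves_of (k : Kind) (Φ : Automorphism X)
    (hΦ : k = Kind.unif → UniformContinuous Φ.toEquiv) : Preserves k Φ := by
  intro f hf
  cases k with
  | unif => exact ⟨Holomorphic.comp_automorphism hf.1 Φ, hf.2.comp (hΦ rfl)⟩
  | bdd => exact Holomorphic.comp_automorphism hf Φ

section SpectrumMap

variable {k : Kind} {Φ : Automorphism X} (h : Preserves k Φ) (h' : Preserves k Φ.symm)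

lemma spectrumMap_apply (φ : Spectrum X k) (f : alg X k) :
    spectrumMap h φ f = φ (compOp h f) := rfl

lemma compOp_compOp_symm (f : alg X k) : compOp h (compOp h' f) = f := by
  refine Subtype.ext (BoundedContinuousFunction.ext fun x => ?_)
  exact congrArg f.1 (Φ.toEquiv.symm_apply_apply x)

lemma compOp_symm_compOp (f : alg X k) : compOp h' (compOp h f) = f := by
  refine Subtype.ext (BoundedContinuousFunction.ext fun x => ?_)
  exact congrArg f.1 (Φ.toEquiv.apply_symm_apply x)

lemma leftInverse_spectrumMap : Function.LeftInverse (spectrumMap h') (spectrumMap h) :=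
  fun φ => WeakDual.CharacterSpace.ext fun f => by
    rw [spectrumMap_apply, spectrumMap_apply, compOp_compOp_symm]

lemma rightInverse_spectrumMap : Function.RightInverse (spectrumMap h') (spectrumMap h) :=
  fun φ => WeakDual.CharacterSpace.ext fun f => by
    rw [spectrumMap_apply, spectrumMap_apply, compOp_symm_compOp]

lemma continuous_spectrumMap : Continuous (spectrumMap h) :=
  Continuous.subtype_mk (WeakDual.continuous_of_continuous_eval fun f =>
    continuous_character_apply (compOp h f)) _

lemma norm_compOp_le (f : alg X k) : ‖compOp h f‖ ≤ ‖f‖ :=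
  (BoundedContinuousFunction.norm_le (norm_nonneg f)).2 fun x =>
    f.1.norm_coe_le_norm (Φ.toEquiv x)

lemma gleasonDist_spectrumMap_le (φ ψ : Spectrum X k) :
    gleasonDist (spectrumMap h φ) (spectrumMap h ψ) ≤ gleasonDist φ ψ := by
  refine ContinuousLinearMap.opNorm_le_bound _ (norm_nonneg (_ : StrongDual ℂ (alg X k))) fun f => ?_
  refine (ContinuousLinearMap.le_opNorm (WeakDual.toStrongDual (φ : WeakDual ℂ (alg X k)) -
    WeakDual.toStrongDual (ψ : WeakDual ℂ (alg X k))) (compOp h f)).trans ?_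
  exact mul_le_mul_of_nonneg_left (norm_compOp_le h f) (norm_nonneg _)


end SpectrumMap

/-! ### Finite type polynomials -/

/-- The value at a point of the bidual of a polynomial expression in functionals. -/
def polyEval (p : MvPolynomial (StrongDual ℂ X) ℂ) (z : Bidual X) : ℂ :=
  MvPolynomial.eval (fun ℓ => z ℓ) p

/-- The function on `X` given by a polynomial expression in functionals. -/
def polyFun (p : MvPolynomial (StrongDual ℂ X) ℂ) (x : X) : ℂ := polyEval p (toBidual x)

lemma exists_polyFun_eq {Q : X → ℂ} (hQ : Q ∈ finiteType X) :
    ∃ p : MvPolynomial (StrongDual ℂ X) ℂ, polyFun p = Q := by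
  rw [finiteType, Algebra.adjoin_range_eq_range_aeval] at hQ
  obtain ⟨p, rfl⟩ := hQ
  refine ⟨p, funext fun x => ?_⟩
  exact (MvPolynomial.comp_aeval_apply (fun (ℓ : StrongDual ℂ X) (x : X) => ℓ x)
    (Pi.evalAlgHom ℂ (fun _ : X => ℂ) x) p).symm

/-- The element of `𝒜` given by a polynomial expression in functionals. -/
def polyAlg (k : Kind) (p : MvPolynomial (StrongDual ℂ X) ℂ) : alg X k :=
  MvPolynomial.aeval (fun ℓ => dualIncl k ℓ) p

lemma character_polyAlg {k : Kind} (φ : Spectrum X k) (p : MvPolynomial (StrongDual ℂ X) ℂ) :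
    φ (polyAlg k p) = polyEval p (proj φ) := by
  exact MvPolynomial.comp_aeval_apply (fun ℓ : StrongDual ℂ X => dualIncl k ℓ)
    (AlgHomClass.toAlgHom φ) p

/-- Evaluation at `x` is itself a character. -/
lemma polyAlg_apply (k : Kind) (p : MvPolynomial (StrongDual ℂ X) ℂ) (x : Ball X) :
    (polyAlg k p).1 x = polyFun p x :=
  character_polyAlg (evalChar k x) p

/-- The derivative of a polynomial expression in the direction of a point of the bidual. -/
def dirDeriv (w : Bidual X) : Derivation ℂ (MvPolynomial (StrongDual ℂ X) ℂ)
    (MvPolynomial (StrongDual ℂ X) ℂ) :=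
  MvPolynomial.mkDerivation ℂ fun ℓ => MvPolynomial.C (w ℓ)

lemma hasDerivAt_polyEval_smul (w : Bidual X) (p : MvPolynomial (StrongDual ℂ X) ℂ) (t : ℂ) :
    HasDerivAt (fun t : ℂ => polyEval p (t • w)) (polyEval (dirDeriv w p) (t • w)) t := by
  induction p using MvPolynomial.induction_on with
  | C a =>
    simp only [polyEval, MvPolynomial.eval_C, MvPolynomial.derivation_C, map_zero]
    exact hasDerivAt_const _ _
  | add p q hp hq =>
    simp only [polyEval, map_add] at *
    exact hp.add hq
  | mul_X p ℓ hp =>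
    have hX : HasDerivAt (fun t : ℂ => (t • w) ℓ) (w ℓ) t := by
      simpa using (hasDerivAt_id t).mul_const (w ℓ)
    refine ((hp.mul hX).congr_deriv ?_).congr_of_eventuallyEq (Eventually.of_forall fun s => ?_)
    · simp only [polyEval, dirDeriv, Derivation.leibniz, map_add, smul_eq_mul, map_mul,
        MvPolynomial.eval_X, MvPolynomial.mkDerivation_X, MvPolynomial.eval_C]
      ring
    · simp only [polyEval, map_mul, MvPolynomial.eval_X, Pi.mul_apply]

lemma iteratedDeriv_polyEval_smul (w : Bidual X) (p : MvPolynomial (StrongDual ℂ X) ℂ) (n : ℕ) :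
    iteratedDeriv n (fun t : ℂ => polyEval p (t • w)) =
      fun t => polyEval ((dirDeriv w)^[n] p) (t • w) := by
  induction n generalizing p with
  | zero => simp
  | succ n ih =>
    rw [iteratedDeriv_succ', Function.iterate_succ_apply, ← ih]
    congr 1
    exact funext fun t => (hasDerivAt_polyEval_smul w p t).deriv

/-- The derivative at `x` is a linear combination of the functionals occurring in `p`; applying `w`
to it replaces each such `ℓ` by `w ℓ`, which is what `dirDeriv w` does formally. -/
lemma hasFDerivAt_polyFun (w : Bidual X) (p : MvPolynomial (StrongDual ℂ X) ℂ) (x : X) :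
    ∃ L : StrongDual ℂ X, HasFDerivAt (polyFun p) L x ∧ w L = polyFun (dirDeriv w p) x := by
  induction p using MvPolynomial.induction_on with
  | C a =>
    refine ⟨0, ?_, ?_⟩
    · unfold polyFun
      simp only [polyEval, MvPolynomial.eval_C]
      exact hasFDerivAt_const _ _
    · simp [polyFun, polyEval, dirDeriv]
  | add p q hp hq =>
    obtain ⟨L, hL, hwL⟩ := hp
    obtain ⟨L', hL', hwL'⟩ := hq
    refine ⟨L + L', ?_, ?_⟩
    · have h := hL.add hL'
      refine h.congr_of_eventuallyEq (Eventually.of_forall fun y => ?_)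
      simp [polyFun, polyEval]
    · simp only [map_add, hwL, hwL', polyFun, polyEval]
  | mul_X p ℓ hp =>
    obtain ⟨L, hL, hwL⟩ := hp
    refine ⟨polyFun p x • ℓ + ℓ x • L, ?_, ?_⟩
    · have h := hL.mul ℓ.hasFDerivAt
      refine h.congr_of_eventuallyEq (Eventually.of_forall fun y => ?_)
      simp [polyFun, polyEval, toBidual]
    · simp only [map_add, map_smul, hwL, smul_eq_mul]
      simp only [polyFun, polyEval, Derivation.leibniz, map_add, smul_eq_mul, map_mul,
        MvPolynomial.eval_X]
      simp [dirDeriv, toBidual]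

lemma contDiff_polyFun (p : MvPolynomial (StrongDual ℂ X) ℂ) : ContDiff ℂ ⊤ (polyFun p) := by
  unfold polyFun polyEval
  induction p using MvPolynomial.induction_on with
  | C a =>
    simp only [MvPolynomial.eval_C]
    exact contDiff_const
  | add p q hp hq =>
    simp only [map_add]
    exact hp.add hq
  | mul_X p ℓ hp =>
    simp only [map_mul, MvPolynomial.eval_X]
    exact hp.mul ℓ.contDiff

/-! ### The Aron–Berner extension of derivatives -/

/-- The extension in the last `n` slots is continuous linear, so it commutes with the outermost
derivative, whose direction is the first slot. -/
lemma aronBerner_iteratedFDeriv_succ (w : Bidual X) (n : ℕ) (f : X → ℂ) (x : X)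
    (hf : DifferentiableAt ℂ (iteratedFDeriv ℂ n f) x) :
    aronBerner w (n + 1) (iteratedFDeriv ℂ (n + 1) f x) =
      w (fderiv ℂ (fun y => aronBerner w n (iteratedFDeriv ℂ n f y)) x) := by
  have h : fderiv ℂ (fun y => aronBerner w n (iteratedFDeriv ℂ n f y)) x =
      (aronBerner w n).comp (fderiv ℂ (iteratedFDeriv ℂ n f) x) :=
    ((aronBerner w n).hasFDerivAt.comp x hf.hasFDerivAt).fderiv
  rw [h]
  rfl

lemma aronBerner_iteratedFDeriv_polyFun (w : Bidual X) (p : MvPolynomial (StrongDual ℂ X) ℂ)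
    (n : ℕ) (x : X) :
    aronBerner w n (iteratedFDeriv ℂ n (polyFun p) x) = polyFun ((dirDeriv w)^[n] p) x := by
  induction n generalizing x with
  | zero => rfl
  | succ n ih =>
    rw [aronBerner_iteratedFDeriv_succ w n _ x
      ((contDiff_polyFun p).differentiable_iteratedFDeriv (by simp) x)]
    simp only [ih]
    obtain ⟨L, hL, hwL⟩ := hasFDerivAt_polyFun w ((dirDeriv w)^[n] p) x
    rw [Function.iterate_succ_apply', ← hwL]
    exact congrArg w hL.fderiv

/-- Both sides are the value at the origin of the `n`-fold formal derivative. This links derivatives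
on `X` to those along a disc in the bidual. -/
lemma aronBerner_iteratedFDeriv_polyFun_zero (w : Bidual X)
    (p : MvPolynomial (StrongDual ℂ X) ℂ) (n : ℕ) :
    aronBerner w n (iteratedFDeriv ℂ n (polyFun p) 0) =
      iteratedDeriv n (fun t : ℂ => polyEval p (t • w)) 0 := by
  rw [aronBerner_iteratedFDeriv_polyFun, iteratedDeriv_polyEval_smul]
  simp only [polyFun, toBidual, map_zero, zero_smul ℂ w]

lemma aronBerner_smul (r : ℂ) (z : Bidual X) (n : ℕ)
    (A : ContinuousMultilinearMap ℂ (fun _ : Fin n => X) ℂ) :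
    aronBerner (r • z) n A = r ^ n * aronBerner z n A := by
  have h : aronBerner (r • z) n = r ^ n • aronBerner z n := by
    clear A
    induction n with
    | zero => simp [aronBerner]
    | succ n ih =>
      ext A
      simp only [aronBerner, ih, ContinuousLinearMap.comp_apply, smul_apply,
        map_smul, smul_eq_mul, pow_succ]
      ring
  rw [h]
  rfl

/-! ### Cauchy estimates -/

lemma norm_fderiv_le_of_norm_le {E : Type*} [NormedAddCommGroup E] [NormedSpace ℂ E] {F : X → E}
    {R M : ℝ} (hR : 0 < R) (hF : DifferentiableOn ℂ F (ball 0 (2 * R)))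
    (hM : ∀ x ∈ ball (0 : X) (2 * R), ‖F x‖ ≤ M) {x : X} (hx : x ∈ ball (0 : X) R) :
    ‖fderiv ℂ F x‖ ≤ 2 * M / R := by
  have hsub : ball x R ⊆ ball 0 (2 * R) :=
    ball_subset_ball' (by rw [mem_ball] at hx; linarith)
  refine Complex.norm_fderiv_le_div_of_mapsTo_ball (hF.mono hsub) (fun y hy => ?_) hR
  rw [mem_closedBall, dist_eq_norm]
  linarith [norm_sub_le (F y) (F x), hM y (hsub hy), hM x (hsub (mem_ball_self hR))]

/-- Each differentiation costs half the radius, which is harmless since only the origin matters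
later. The constant must not depend on `f`, because the bound is applied to differences `p m - f`.
-/
lemma exists_norm_iteratedFDeriv_le (n : ℕ) :
    ∃ C : ℝ, ∀ (f : X → ℂ) (M : ℝ), AnalyticOnNhd ℂ f (ball 0 1) →
      (∀ x ∈ ball (0 : X) 1, ‖f x‖ ≤ M) →
      ∀ x ∈ ball (0 : X) (1 / 2 ^ n), ‖iteratedFDeriv ℂ n f x‖ ≤ C * M := by
  induction n with
  | zero => exact ⟨1, fun f M _ hM x hx => by simpa using hM x (by simpa using hx)⟩
  | succ n ih =>
    obtain ⟨C, hC⟩ := ih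
    refine ⟨2 * C / (1 / 2 ^ (n + 1)), fun f M hf hM x hx => ?_⟩
    have e : 2 * (1 / 2 ^ (n + 1)) = (1 / 2 ^ n : ℝ) := by
      rw [pow_succ]; field_simp
    have h1 : (1 / 2 ^ n : ℝ) ≤ 1 := by
      rw [div_le_one (by positivity)]
      exact one_le_pow₀ one_le_two
    rw [← norm_fderiv_iteratedFDeriv]
    refine (norm_fderiv_le_of_norm_le (M := C * M) (by positivity) ?_ ?_ hx).trans_eq (by ring)
    · rw [e]
      exact (hf.iteratedFDeriv n).differentiableOn.mono (ball_subset_ball h1)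
    · rw [e]
      exact hC f M hf hM

/-! ### Uniform limits of finite type polynomials -/

lemma exists_tendsto_polyAlg {k : Kind} {f : alg X k} (hf : IsUniformLimitFiniteType f.1) :
    ∃ p : ℕ → MvPolynomial (StrongDual ℂ X) ℂ,
      Tendsto (fun n => polyAlg k (p n)) atTop (𝓝 f) := by
  obtain ⟨Q, hQ, hlim⟩ := hf
  choose p hp using fun n => exists_polyFun_eq (hQ n)
  refine ⟨p, tendsto_subtype_rng.2 ?_⟩
  rw [BoundedContinuousFunction.tendsto_iff_tendstoUniformly]
  convert hlim using 3 with n x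
  rw [polyAlg_apply, hp]

/-- A character is multiplicative, so its values on `X*` determine it on finite type polynomials,
and by continuity on their uniform limits. -/
lemma character_eq_of_proj_eq {k : Kind} {f : alg X k} (hf : IsUniformLimitFiniteType f.1)
    {φ ψ : Spectrum X k} (h : proj φ = proj ψ) : φ f = ψ f := by
  obtain ⟨p, hp⟩ := exists_tendsto_polyAlg hf
  have h1 := ((map_continuous φ).tendsto f).comp hp
  have h2 := ((map_continuous ψ).tendsto f).comp hp
  refine tendsto_nhds_unique h1 (h2.congr fun n => ?_)
  simp only [Function.comp_apply, character_polyAlg, h]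

lemma holomorphic_of_mem_alg {k : Kind} (f : alg X k) : Holomorphic f.1 := by
  cases k with
  | unif => exact f.2.1
  | bdd => exact f.2

lemma tendsto_iteratedFDeriv_of_tendsto {k : Kind} {f : alg X k}
    {p : ℕ → MvPolynomial (StrongDual ℂ X) ℂ}
    (hp : Tendsto (fun m => polyAlg k (p m)) atTop (𝓝 f)) (n : ℕ) :
    Tendsto (fun m => iteratedFDeriv ℂ n (polyFun (p m)) 0) atTop
      (𝓝 (iteratedFDeriv ℂ n (zeroExt f.1) 0)) := by
  obtain ⟨C, hC⟩ := exists_norm_iteratedFDeriv_le (X := X) n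
  have hf : AnalyticOnNhd ℂ (zeroExt f.1) (ball (0 : X) 1) := holomorphic_of_mem_alg f
  have hpa : ∀ m, AnalyticOnNhd ℂ (polyFun (p m)) (ball (0 : X) 1) := fun m x _ =>
    (contDiff_polyFun (p m)).contDiffAt.analyticAt
  have h0 : (0 : X) ∈ ball (0 : X) 1 := mem_ball_self one_pos
  rw [tendsto_iff_norm_sub_tendsto_zero] at hp ⊢
  have hlim : Tendsto (fun m => C * ‖polyAlg k (p m) - f‖) atTop (𝓝 0) := by
    have h := hp.const_mul C
    rwa [mul_zero] at h
  refine squeeze_zero (fun _ => norm_nonneg _) (fun m => ?_) hlim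
  rw [← iteratedFDeriv_sub_apply (hpa m 0 h0).contDiffAt (hf 0 h0).contDiffAt]
  refine hC _ _ ((hpa m).sub hf) (fun x hx => ?_) 0 (mem_ball_self (by positivity))
  rw [Pi.sub_apply, zeroExt_coe f.1 ⟨x, hx⟩, ← polyAlg_apply k (p m) ⟨x, hx⟩]
  exact (polyAlg k (p m) - f).1.norm_coe_le_norm ⟨x, hx⟩

lemma tendstoLocallyUniformlyOn_iteratedDeriv {F : ℕ → ℂ → ℂ} {g : ℂ → ℂ} {U : Set ℂ}
    (hU : IsOpen U) (hF : ∀ m, DifferentiableOn ℂ (F m) U)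
    (h : TendstoLocallyUniformlyOn F g atTop U) (n : ℕ) :
    TendstoLocallyUniformlyOn (fun m => iteratedDeriv n (F m)) (iteratedDeriv n g) atTop U := by
  induction n generalizing F g with
  | zero => simpa using h
  | succ n ih =>
    simp only [iteratedDeriv_succ']
    exact ih (fun m => (hF m).deriv hU) (h.deriv (Eventually.of_forall hF) hU)

lemma norm_smul_bidual (c : ℂ) (w : Bidual X) : ‖c • w‖ = ‖c‖ * ‖w‖ :=
  NormedSpace.toNormSMulClass.norm_smul c w

/-- On a uniform limit of finite type polynomials, a character over a point `z` of the open unit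
ball of the bidual takes the value at `z` of the canonical extension. -/
theorem character_eq_canonicalExt {k : Kind} {f : alg X k} (hf : IsUniformLimitFiniteType f.1)
    (φ : Spectrum X k) (hφ : ‖proj φ‖ < 1) : φ f = canonicalExt f.1 (proj φ) := by
  obtain ⟨p, hp⟩ := exists_tendsto_polyAlg hf
  obtain ⟨r, hr, hr1⟩ := exists_between hφ
  have hr0 : 0 < r := (norm_nonneg (proj φ)).trans_lt hr
  have hrc : (r : ℂ) ≠ 0 := by exact_mod_cast hr0.ne'
  -- The given point is placed at parameter `r < 1` of the disc `t ↦ t • w`, strictly inside, so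
  -- that a one-variable Taylor expansion reaches it.
  obtain ⟨w, hw, hwz⟩ : ∃ w : Bidual X, ‖w‖ ≤ 1 ∧ (r : ℂ) • w = proj φ := by
    refine ⟨(r : ℂ)⁻¹ • proj φ, ?_, smul_inv_smul₀ hrc _⟩
    rw [norm_smul_bidual, norm_inv, Complex.norm_real, Real.norm_of_nonneg hr0.le]
    exact (inv_mul_le_one₀ hr0).2 hr.le
  -- `F` is `f` viewed on the bidual ball; its value 0 outside the range of `proj` is never used.
  obtain ⟨F, hF⟩ : ∃ F : Bidual X → ℂ, ∀ ψ : Spectrum X k, F (proj ψ) = ψ f :=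
    ⟨Function.extend proj (fun ψ : Spectrum X k => ψ f) 0, fun ψ =>
      Function.FactorsThrough.extend_apply (fun _ _ h => character_eq_of_proj_eq hf h) _ ψ⟩
  have hunif : TendstoUniformlyOn (fun m (t : ℂ) => polyEval (p m) (t • w))
      (fun t => F (t • w)) atTop (ball 0 1) := by
    rw [Metric.tendstoUniformlyOn_iff]
    intro ε hε
    filter_upwards [(Metric.tendsto_nhds.1 hp) ε hε] with m hm t ht
    have htw : ‖t • w‖ ≤ 1 := by
      rw [norm_smul_bidual]
      exact mul_le_one₀ (mem_ball_zero_iff.1 ht).le (norm_nonneg w) hw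
    -- A character over `t • w` carries the sup-norm estimate from the ball of `X` to this point of
    -- the bidual.
    obtain ⟨ψ, hψ⟩ := surjective_projBall (k := k) ⟨StrongDual.toWeakDual (t • w), htw⟩
    have hψ' : proj ψ = t • w := congrArg bidualPt hψ
    rw [← hψ', hF, ← character_polyAlg, dist_comm, dist_eq_norm, ← map_sub]
    rw [dist_eq_norm] at hm
    exact (norm_character_apply_le ψ _).trans_lt hm
  have hdiff : ∀ m, DifferentiableOn ℂ (fun t : ℂ => polyEval (p m) (t • w)) (ball 0 1) :=
    fun m t _ => (hasDerivAt_polyEval_smul w (p m) t).differentiableAt.differentiableWithinAt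
  have hloc := hunif.tendstoLocallyUniformlyOn
  have hg := hloc.differentiableOn (Eventually.of_forall hdiff) isOpen_ball
  have hcoef : ∀ n, iteratedDeriv n (fun t : ℂ => F (t • w)) 0 =
      aronBerner w n (iteratedFDeriv ℂ n (zeroExt f.1) 0) := fun n => by
    -- Both sides are limits of the same sequence, the `n`-th derivatives at 0 of the polynomials
    -- along the disc.
    refine tendsto_nhds_unique ((tendstoLocallyUniformlyOn_iteratedDeriv isOpen_ball hdiff hloc
      n).tendsto_at (mem_ball_self one_pos)) ?_
    simp only [← aronBerner_iteratedFDeriv_polyFun_zero]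
    exact ((aronBerner w n).continuous.tendsto _).comp (tendsto_iteratedFDeriv_of_tendsto hp n)
  have hrmem : (r : ℂ) ∈ ball (0 : ℂ) 1 := by
    rwa [mem_ball_zero_iff, Complex.norm_real, Real.norm_of_nonneg hr0.le]
  have hsum := Complex.taylorSeries_eq_on_ball hg hrmem
  rw [hwz, hF] at hsum
  rw [← hsum, canonicalExt]
  refine tsum_congr fun n => ?_
  rw [hcoef, ← hwz, aronBerner_smul, sub_zero, smul_eq_mul, smul_eq_mul]

/-! ### The map induced on the bidual ball -/

section InducedMap

variable {k : Kind} {Φ : Automorphism X} (h : Preserves k Φ)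

/-- At `ℓ`, the projection of `Λ_Φ φ` is `φ (ℓ ∘ Φ)`, and `ℓ ∘ Φ` is a uniform limit of finite type
polynomials. -/
lemma projBall_spectrumMap_eq
    (hlim : ∀ ℓ : StrongDual ℂ X, IsUniformLimitFiniteType fun x => ℓ (Φ.toEquiv x))
    {φ ψ : Spectrum X k} (e : projBall φ = projBall ψ) :
    projBall (spectrumMap h φ) = projBall (spectrumMap h ψ) :=
  bidualPt_injective <| ContinuousLinearMap.ext fun ℓ =>
    character_eq_of_proj_eq (f := compOp h (dualIncl k ℓ)) (hlim ℓ) (congrArg bidualPt e)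

/-- If `Φ` is weakly approximable by finite type polynomials, then `Λ_Φ` induces a weak-star
continuous map on the closed unit ball of the bidual. -/
theorem exists_inducedMap
    (hlim : ∀ ℓ : StrongDual ℂ X, IsUniformLimitFiniteType fun x => ℓ (Φ.toEquiv x)) :
    ∃ Ψ : C(BidualBall X, BidualBall X),
      ∀ φ : Spectrum X k, Ψ (projBall φ) = projBall (spectrumMap h φ) := by
  let π : C(Spectrum X k, BidualBall X) := ⟨projBall, continuous_projBall⟩
  have hπ : Topology.IsQuotientMap π := isQuotientMap_projBall
  let g : C(Spectrum X k, BidualBall X) :=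
    ⟨fun φ => projBall (spectrumMap h φ), continuous_projBall.comp (continuous_spectrumMap h)⟩
  have hg : ∀ φ ψ, π φ = π ψ → g φ = g ψ := fun φ ψ e => projBall_spectrumMap_eq h hlim e
  exact ⟨hπ.lift g hg, fun φ => DFunLike.congr_fun (hπ.lift_comp g hg) φ⟩

lemma mem_fiber_bidualPt {φ : Spectrum X k} {z : BidualBall X} :
    φ ∈ fiber k (bidualPt z) ↔ projBall φ = z :=
  ⟨fun e => bidualPt_injective e, fun e => congrArg bidualPt e⟩

lemma image_fiber_eq (h' : Preserves k Φ.symm)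
    (hlim' : ∀ ℓ : StrongDual ℂ X, IsUniformLimitFiniteType fun x => ℓ (Φ.toEquiv.symm x))
    {Ψ : BidualBall X → BidualBall X}
    (hΨ : ∀ φ : Spectrum X k, Ψ (projBall φ) = projBall (spectrumMap h φ)) (z : BidualBall X) :
    spectrumMap h '' fiber k (bidualPt z) = fiber k (bidualPt (Ψ z)) := by
  ext φ
  rw [mem_fiber_bidualPt]
  constructor
  · rintro ⟨ψ, hψ, rfl⟩
    rw [← hΨ, mem_fiber_bidualPt.1 hψ]
  · intro hφ
    -- This preimage lies over `z`: if `ψ` lies over `z`, then `φ` and `Λ_Φ ψ` share a fiber, hence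
    -- so do their images under the inverse map, the second being `ψ`.
    refine ⟨spectrumMap h' φ, mem_fiber_bidualPt.2 ?_, rightInverse_spectrumMap h h' φ⟩
    obtain ⟨ψ, rfl⟩ := surjective_projBall (k := k) z
    rw [hΨ] at hφ
    rw [projBall_spectrumMap_eq h' hlim' hφ, leftInverse_spectrumMap h h' ψ]

end InducedMap

/-! ### Extensions to the closed unit ball -/

/-- The inclusion of the open unit ball into the closed one. -/
def ballIncl : Ball X → ClosedBall X := Set.inclusion ball_subset_closedBall

lemma denseRange_ballIncl : DenseRange (ballIncl : Ball X → ClosedBall X) := by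
  rw [ballIncl, denseRange_inclusion_iff, closure_ball (0 : X) one_ne_zero]

lemma isUniformInducing_ballIncl : IsUniformInducing (ballIncl : Ball X → ClosedBall X) :=
  (isUniformEmbedding_set_inclusion ball_subset_closedBall).isUniformInducing

lemma exists_isContinuousExtension [CompleteSpace X] (Φ : Automorphism X)
    (hΦ : UniformContinuous Φ.toEquiv) :
    ∃ Φ' : C(ClosedBall X, ClosedBall X), IsContinuousExtension Φ Φ' := by
  have : CompleteSpace (ClosedBall X) := isClosed_closedBall.completeSpace_coe
  have hu : UniformContinuous fun x => ballIncl (Φ.toEquiv x) :=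
    isUniformInducing_ballIncl.uniformContinuous.comp hΦ
  have hd := isUniformInducing_ballIncl.isDenseInducing (denseRange_ballIncl (X := X))
  refine ⟨⟨hd.extend fun x => ballIncl (Φ.toEquiv x),
    (uniformContinuous_uniformly_extend isUniformInducing_ballIncl denseRange_ballIncl
      hu).continuous⟩, fun x => ?_⟩
  exact congrArg Subtype.val (uniformly_extend_of_ind isUniformInducing_ballIncl
    denseRange_ballIncl hu x)

lemma IsContinuousExtension.eq {Φ : Automorphism X} {Φ₁ Φ₂ : C(ClosedBall X, ClosedBall X)}
    (h₁ : IsContinuousExtension Φ Φ₁) (h₂ : IsContinuousExtension Φ Φ₂) : Φ₁ = Φ₂ :=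
  DFunLike.coe_injective <| denseRange_ballIncl.equalizer Φ₁.continuous Φ₂.continuous <|
    funext fun x => Subtype.ext ((h₁ x).trans (h₂ x).symm)

lemma IsWeakStarExtension.eq {Φ : Automorphism X} {Φ₁ Φ₂ : C(ClosedBall X, BidualBall X)}
    (h₁ : IsWeakStarExtension Φ Φ₁) (h₂ : IsWeakStarExtension Φ Φ₂) : Φ₁ = Φ₂ :=
  DFunLike.coe_injective <| denseRange_ballIncl.equalizer Φ₁.continuous Φ₂.continuous <|
    funext fun x => bidualPt_injective ((h₁ x).trans (h₂ x).symm)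

lemma IsContinuousExtension.isWeakStarExtension {Φ : Automorphism X}
    {Φ' : C(ClosedBall X, ClosedBall X)} (h : IsContinuousExtension Φ Φ') :
    IsWeakStarExtension Φ ((⟨inclBall, continuous_inclBall⟩ : C(ClosedBall X, BidualBall X)).comp
      Φ') :=
  fun x => congrArg toBidual (h x)

/-- The series formula already fixes the values on the open ball of `X`, which is weak-star dense by
Goldstine. -/
lemma IsCanonicalExtension.eq {Φ : Automorphism X} {Ψ₁ Ψ₂ : C(BidualBall X, BidualBall X)}
    (h₁ : IsCanonicalExtension Φ Ψ₁) (h₂ : IsCanonicalExtension Φ Ψ₂) : Ψ₁ = Ψ₂ := by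
  refine DFunLike.coe_injective <| dense_range_inclBall_ball.equalizer Ψ₁.continuous
    Ψ₂.continuous <| funext fun x => bidualPt_injective <| ContinuousLinearMap.ext fun ℓ => ?_
  have hx : ‖bidualPt (inclBall (X := X) ⟨x, ball_subset_closedBall x.2⟩)‖ < 1 :=
    (norm_toBidual_le (x : X)).trans_lt (mem_ball_zero_iff.1 x.2)
  exact (h₁ _ hx ℓ).trans (h₂ _ hx ℓ).symm

end BallAlgebra

end

open BallAlgebra in
theorem mainTheorem11 {X : Type*} [NormedAddCommGroup X] [NormedSpace ℂ X] [CompleteSpace X]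
    (k : Kind) (Φ : Automorphism X)
    (hΦ : k = Kind.unif → UniformContinuous Φ.toEquiv ∧ UniformContinuous Φ.toEquiv.symm) :
    ∃ (h : Preserves k Φ) (h' : Preserves k Φ.symm),
      -- `Λ_Φ` is an onto isometry for the Gleason metric with inverse `Λ_{Φ⁻¹}`
      (∀ φ ψ : Spectrum X k,
        gleasonDist (spectrumMap h φ) (spectrumMap h ψ) = gleasonDist φ ψ) ∧
      Function.Surjective (spectrumMap h) ∧
      Function.LeftInverse (spectrumMap h') (spectrumMap h) ∧
      Function.RightInverse (spectrumMap h') (spectrumMap h) ∧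
      ((∀ ℓ : StrongDual ℂ X,
          IsUniformLimitFiniteType (fun x => ℓ (Φ.toEquiv x)) ∧
          IsUniformLimitFiniteType (fun x => ℓ (Φ.toEquiv.symm x))) →
        -- fibers over points of the open ball of `X`
        (∀ x : Ball X, spectrumMap h '' fiber k (toBidual (x : X)) =
          fiber k (toBidual (Φ.toEquiv x : X))) ∧
        -- fibers over points of the closed ball of `X`, where `Φ` extends by continuity
        (∃! Φ' : C(ClosedBall X, BidualBall X), IsWeakStarExtension Φ Φ') ∧
        (∀ Φ' : C(ClosedBall X, BidualBall X), IsWeakStarExtension Φ Φ' →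
          ∀ x : ClosedBall X,
            spectrumMap h '' fiber k (toBidual (x : X)) = fiber k (bidualPt (Φ' x))) ∧
        (UniformContinuous Φ.toEquiv →
          (∃! Φ' : C(ClosedBall X, ClosedBall X), IsContinuousExtension Φ Φ') ∧
          ∀ Φ' : C(ClosedBall X, ClosedBall X), IsContinuousExtension Φ Φ' →
            ∀ x : ClosedBall X,
              spectrumMap h '' fiber k (toBidual (x : X)) = fiber k (toBidual (Φ' x : X))) ∧
        -- fibers over points of the closed ball of `X**`
        (SymmetricallyRegular X →
          (∃! Ψ : C(BidualBall X, BidualBall X), IsCanonicalExtension Φ Ψ) ∧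
          ∀ Ψ : C(BidualBall X, BidualBall X), IsCanonicalExtension Φ Ψ →
            ∀ z : BidualBall X,
              spectrumMap h '' fiber k (bidualPt z) = fiber k (bidualPt (Ψ z)))) := by
  have h : Preserves k Φ := preserves_of k Φ fun e => (hΦ e).1
  have h' : Preserves k Φ.symm := preserves_of k Φ.symm fun e => (hΦ e).2
  refine ⟨h, h', fun φ ψ => (gleasonDist_spectrumMap_le h φ ψ).antisymm ?_,
    (rightInverse_spectrumMap h h').surjective, leftInverse_spectrumMap h h',
    rightInverse_spectrumMap h h', fun hlim => ?_⟩
  · have hle := gleasonDist_spectrumMap_le h' (spectrumMap h φ) (spectrumMap h ψ)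
    rwa [leftInverse_spectrumMap h h' φ, leftInverse_spectrumMap h h' ψ] at hle
  obtain ⟨Ψ, hΨ⟩ := exists_inducedMap h fun ℓ => (hlim ℓ).1
  have himage := image_fiber_eq h h' (fun ℓ => (hlim ℓ).2) hΨ
  -- `Λ_Φ` sends evaluation at `x` to evaluation at `Φ x`.
  have hball : ∀ x : Ball X, bidualPt (Ψ (inclBall (ballIncl x))) = toBidual (Φ.toEquiv x : X) :=
    fun x => congrArg bidualPt (hΨ (evalChar k x))
  have hweak : IsWeakStarExtension Φ (Ψ.comp ⟨inclBall, continuous_inclBall⟩) := hball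
  have hweakImage : ∀ Φ' : C(ClosedBall X, BidualBall X), IsWeakStarExtension Φ Φ' →
      ∀ x : ClosedBall X,
        spectrumMap h '' fiber k (toBidual (x : X)) = fiber k (bidualPt (Φ' x)) := by
    intro Φ' hΦ' x
    rw [hΦ'.eq hweak]
    exact himage (inclBall x)
  refine ⟨fun x => ?_, ⟨_, hweak, fun Φ' hΦ' => hΦ'.eq hweak⟩, hweakImage, fun hu => ⟨?_, ?_⟩,
    fun _ => ?_⟩
  · rw [← hball]
    exact himage (inclBall (ballIncl x))
  · obtain ⟨Φ', hΦ'⟩ := exists_isContinuousExtension Φ hu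
    exact ⟨Φ', hΦ', fun Φ'' hΦ'' => hΦ''.eq hΦ'⟩
  · exact fun Φ' hΦ' => hweakImage _ hΦ'.isWeakStarExtension
  · have hcan : IsCanonicalExtension Φ Ψ := by
      intro z hz ℓ
      -- With `z` written as the projection of `φ`, the value of `Ψ z` at `ℓ` becomes `φ (ℓ ∘ Φ)`.
      obtain ⟨φ, rfl⟩ := surjective_projBall (k := k) z
      rw [hΨ]
      exact character_eq_canonicalExt (f := compOp h (dualIncl k ℓ)) (hlim ℓ).1 φ hz
    refine ⟨⟨Ψ, hcan, fun Ψ' hΨ' => hΨ'.eq hcan⟩, fun Ψ' hΨ' => ?_⟩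
    rw [hΨ'.eq hcan]
    exact himage
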